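/- Let $d\in\mathbb N\cup\{\infty\}$, let $\mathbb F^d$ be the free monoid of words in $d$ letters, and let $H^2=\ell^2(\mathbb F^d)$ be the full Fock space over $\mathbb C^d$ (NC Hardy space), whose elements are viewed as power series $f(\mathfrak z)=\sum_{\alpha}\hat f_\alpha \mathfrak z^\alpha$ in $d$ non-commuting variables with square-summable coefficients. Such an $f$ has a value $f(Z)=\sum_\alpha \hat f_\alpha Z^\alpha$ (norm-convergent) at every strict row contraction $Z=(Z_1,\dots,Z_d)$, $\|\sum_k Z_kZ_k^*\|<1$, on $\mathbb C^n$, where $n\in\mathbb N\cup\{\infty\}$ and $\mathbb C^\infty:=\ell^2(\mathbb N)$. A left multiplier is a bounded operator on $H^2$ of the form $H(L): f\mapsto H\cdot f$, left multiplication by a power series $H=H(L)1$. The left free shifts are $L_k:f\mapsto \mathfrak z_k f$, and the NC disk algebra $\mathcal A_d$ is the operator-norm closure of the unital algebra generated by the $L_k$. A left multiplier is inner if it is an isometry, and outer if it has dense range; an inner-outer factorization of $H$ is $H(L)=\Theta(L)F(L)$ with $\Theta$ inner (the inner factor) and $F$ outer. For $h\in H^2$ let $\mathscr S(h)$ be the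 set of all $f\in H^2$ such that $y^*f(Z)=0$ for every $n\in\mathbb N\cup\{\infty\}$, every strict row contraction $Z$ on $\mathbb C^n$ and every $y\in\mathbb C^n$ with $y^*h(Z)=0$. An inner $\Theta$ is NC Blaschke if $\operatorname{ran}\Theta(L)=\mathscr S(\Theta)$. **Theorem.** Let $H(L)\in\mathcal A_d$ be non-zero with closed range. Then $H$ has an inner-outer factorization, and in every inner-outer factorization $H=\Theta F$ the inner factor $\Theta$ is NC Blaschke. In particular, every isometry in $\mathcal A_d$ is NC Blaschke. -/

import Mathlib

open scoped ENNReal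

/-- The free monoid on the letters `ι`: words, with concatenation `++` as product and `[]` as unit.
The alphabet of `d` letters is `ι = Fin d` for finite `d` and `ι = ℕ` for `d = ∞`. -/
abbrev Word (ι : Type*) : Type _ := List ι

/-- The full Fock space, that is the NC Hardy space `H²`: square-summable families `f` of
coefficients indexed by words, viewed as power series `f(z) = ∑ f α z^α` in the non-commuting
variables `z_k`, `k : ι`. -/
noncomputable abbrev NCHardy (ι : Type*) : Type _ := lp (fun _ : Word ι => ℂ) 2

namespace NCHardy

open scoped Classical in
/-- Coefficients of the power series `z_k f(z)`. -/
noncomputable def shiftCoeff {ι : Type*} (k : ι) (f : Word ι → ℂ) : Word ι → ℂ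
  | [] => 0
  | j :: β => if j = k then f β else 0

theorem hasSum_shiftCoeff {ι : Type*} (k : ι) (f : NCHardy ι) :
    HasSum (fun γ => ‖shiftCoeff k f γ‖ ^ (2 : ℝ≥0∞).toReal)
      (‖f‖ ^ (2 : ℝ≥0∞).toReal) := by
  have hinj : Function.Injective (fun β : Word ι => k :: β) := fun a b h => by
    simpa using h
  refine (hinj.hasSum_iff ?_).1 ?_
  · intro γ hγ
    cases γ with
    | nil => simp [shiftCoeff]
    | cons j β =>
      have hj : j ≠ k := fun h => hγ ⟨β, by simp [h]⟩
      simp [shiftCoeff, hj]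
  · have h := lp.hasSum_norm (p := 2) (by norm_num) f
    simpa [Function.comp_def, shiftCoeff] using h

/-- The left free shift `L_k`: left multiplication by the variable `z_k`, mapping the basis
vector `e_α` to `e_{kα}`. -/
noncomputable def leftShift {ι : Type*} (k : ι) : NCHardy ι →ₗᵢ[ℂ] NCHardy ι where
  toFun f := ⟨shiftCoeff k f, memℓp_gen (hasSum_shiftCoeff k f).summable⟩
  map_add' f g := by
    ext γ
    change shiftCoeff k (f + g : NCHardy ι) γ = shiftCoeff k f γ + shiftCoeff k g γ
    rcases γ with _ | ⟨j, β⟩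
    · simp [shiftCoeff]
    · by_cases h : j = k <;> simp [shiftCoeff, h]
  map_smul' c f := by
    ext γ
    rcases γ with _ | ⟨j, β⟩
    · simp [shiftCoeff]
    · by_cases h : j = k <;> simp [shiftCoeff, h]
  norm_map' f := by
    have h1 := hasSum_shiftCoeff k f
    have h2 := lp.hasSum_norm (p := 2) (by norm_num)
      (⟨shiftCoeff k f, memℓp_gen h1.summable⟩ : NCHardy ι)
    have h3 := h2.unique h1
    simpa [sq_eq_sq₀] using h3

/-- The NC disk algebra `A_d`, `d = |ι|`: the operator-norm closure of the unital algebra generated by the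
left free shifts. -/
noncomputable def diskAlgebra (ι : Type*) : Subalgebra ℂ (NCHardy ι →L[ℂ] NCHardy ι) :=
  (Algebra.adjoin ℂ
    (Set.range fun k : ι => (leftShift k).toContinuousLinearMap)).topologicalClosure

/-- The product of two power series in non-commuting variables: the coefficient at the word `γ` is
the sum of `φ α * f β` over all ways to write `γ = αβ`. -/
def cauchyProduct {ι : Type*} (φ f : Word ι → ℂ) (γ : Word ι) : ℂ :=
  ∑ i ∈ Finset.range (γ.length + 1), φ (γ.take i) * f (γ.drop i)

/-- `T` belongs to the NC Hardy algebra `H^∞`: it is the (bounded) operator `f ↦ φ f` of left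
multiplication by a power series `φ`. Then `φ = T 1`. -/
def IsLeftMultiplier {ι : Type*} (T : NCHardy ι →L[ℂ] NCHardy ι) : Prop :=
  ∃ φ : Word ι → ℂ, ∀ (f : NCHardy ι) (γ : Word ι), T f γ = cauchyProduct φ f γ

open scoped Classical in
/-- The constant function `1`, i.e. the vacuum vector. -/
noncomputable def vacuum (ι : Type*) : NCHardy ι := lp.single 2 ([] : Word ι) (1 : ℂ)

/-- `T(L)` is NC inner: an isometric left multiplier. -/
def IsInner {ι : Type*} (T : NCHardy ι →L[ℂ] NCHardy ι) : Prop :=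
  IsLeftMultiplier T ∧ Isometry T

/-- `T(L)` is NC outer: a left multiplier with dense range. -/
def IsOuter {ι : Type*} (T : NCHardy ι →L[ℂ] NCHardy ι) : Prop :=
  IsLeftMultiplier T ∧ DenseRange T

/-- `H = Θ F` is an inner-outer factorization: `Θ` is the inner factor, `F` the outer factor. -/
def IsInnerOuterFactorization {ι : Type*} (H Θ F : NCHardy ι →L[ℂ] NCHardy ι) : Prop :=
  IsInner Θ ∧ IsOuter F ∧ H = Θ ∘L F

section Evaluation

variable {ι : Type*} {E : Type*} [NormedAddCommGroup E] [InnerProductSpace ℂ E] [CompleteSpace E]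

/-- `Z = (Z_k)` is a strict row contraction on `E`: the row operator `Z : E ⊗ ℂ^d → E` has norm less
than `1`, i.e. `Z Z^* = ∑ Z_k Z_k^*` has norm less than `1`. As the partial sums increase, this says
that their norms are bounded by some `r < 1`; for finite `ι` it is just `‖∑ k, Z_k Z_k^*‖ < 1`. -/
def IsStrictRowContraction (Z : ι → E →L[ℂ] E) : Prop :=
  ∃ r : ℝ, r < 1 ∧ ∀ s : Finset ι, ‖∑ k ∈ s, Z k ∘L ContinuousLinearMap.adjoint (Z k)‖ ≤ r

/-- The value `f(Z) = ∑ f_α Z^α`. For a strict row contraction `Z` the series converges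
unconditionally in operator norm, since by grouping words by length
`‖∑_{α ∈ A} f_α Z^α‖ ≤ ∑_n r^n (∑_{α ∈ A, |α| = n} |f_α|²)^{1/2}`, `r < 1` the norm of the row. -/
noncomputable def eval (f : NCHardy ι) (Z : ι → E →L[ℂ] E) : E →L[ℂ] E :=
  ∑' α : Word ι, f α • (α.map Z).prod

/-- The part over the Hilbert space `E` of the left NC variety of `h`: the pairs `(Z, y)` with `Z` a
strict row contraction on `E` and `y^* h(Z) = 0`. -/
def Sing (E : Type*) [NormedAddCommGroup E] [InnerProductSpace ℂ E] [CompleteSpace E]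
    (h : NCHardy ι) : Set ((ι → E →L[ℂ] E) × E) :=
  {p | IsStrictRowContraction p.1 ∧ ∀ x : E, inner ℂ p.2 (eval h p.1 x) = 0}

end Evaluation

/-- The singularity space of `h`: all `f ∈ H²` such that `y^* f(Z) = 0` whenever `(Z, y)` is in the
left NC variety of `h`, at the finite levels `ℂ^n` and at the infinite level `ℓ²(ℕ)`. -/
def singularitySpace {ι : Type*} (h : NCHardy ι) : Set (NCHardy ι) :=
  {f | (∀ n : ℕ, ∀ p ∈ Sing (EuclideanSpace ℂ (Fin n)) h, ∀ x, inner ℂ p.2 (eval f p.1 x) = 0) ∧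
    ∀ p ∈ Sing (lp (fun _ : ℕ => ℂ) 2) h, ∀ x, inner ℂ p.2 (eval f p.1 x) = 0}

/-- `Θ(L)` is NC Blaschke: it is NC inner and its range is the singularity space of the function
`Θ = Θ(L) 1`. -/
def IsBlaschke {ι : Type*} (T : NCHardy ι →L[ℂ] NCHardy ι) : Prop :=
  IsInner T ∧ Set.range T = singularitySpace (T (vacuum ι))

end NCHardy

/-! A nonzero left multiplier is injective, since the lowest-degree terms of two power series cannot
cancel in their product; so `H` with closed range is bounded below. For `H` in the disk algebra the
dilations `H(rL)` converge to `H` in operator norm as `r → 1`, hence they are bounded below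
uniformly for `r` near `1`. This is where membership in the disk algebra is essential.

Let `f` lie in the singularity space of `H`. The tuple `rL` is a strict row contraction on the Fock
space, and each `y ⊥ ran H(rL)` gives a point `(rL, y)` of the left variety of `H`. So `f(rL)1` is
orthogonal to every such `y`, and `f(rL)1 = H(rL) g_r` with `‖g_r‖` bounded in `r`. Then `H g_r →
f`, and closedness puts `f` in `ran H` (`mem_range_of_mem_singularitySpace`).

If `H = ΘF`, closed range makes the outer factor `F` surjective, so `F(Z)` has a right inverse at
every `Z`, and `H` and `Θ` have the same left variety. Thus the singularity space of `Θ` lies in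
`ran H ⊆ ran Θ`; the other inclusion is multiplicativity of evaluation (`eval_mul`).

Existence of the factorization is a Beurling argument: a wandering vector of `ran H` for the right
shifts serves as `Θ 1`. -/

namespace NCHardy

variable {ι : Type*} {E : Type*} [NormedAddCommGroup E] [InnerProductSpace ℂ E] [CompleteSpace E]

/-! ### The standard basis and the right shifts -/

open scoped Classical in
/-- The monomial `z^w`, as a standard basis vector of the Fock space. -/
noncomputable def monomial (w : Word ι) : NCHardy ι := lp.single 2 w (1 : ℂ)

theorem vacuum_eq_monomial : vacuum ι = monomial [] := rfl

open scoped Classical in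
theorem monomial_apply (w γ : Word ι) : monomial w γ = if γ = w then 1 else 0 := by
  simp [monomial, lp.single_apply, Pi.single_apply]

theorem inner_monomial_left (w : Word ι) (f : NCHardy ι) : inner ℂ (monomial w) f = f w := by
  classical
  simpa [monomial] using lp.inner_single_left (𝕜 := ℂ) (G := fun _ : Word ι => ℂ) w 1 f

theorem norm_monomial (w : Word ι) : ‖monomial w‖ = 1 := by
  classical
  simp [monomial, lp.norm_single]

theorem orthonormal_monomial : Orthonormal ℂ (monomial : Word ι → NCHardy ι) := by
  classical
  rw [orthonormal_iff_ite]
  intro i j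
  rw [inner_monomial_left, monomial_apply]

theorem hasSum_monomial (f : NCHardy ι) : HasSum (fun w => f w • monomial w) f := by
  classical
  have h := lp.hasSum_single (E := fun _ : Word ι => ℂ) (p := 2) (by norm_num) f
  convert h using 2 with w
  rw [monomial, ← lp.single_smul]
  simp

theorem ext_monomial {F : Type*} [NormedAddCommGroup F] [NormedSpace ℂ F]
    {T S : NCHardy ι →L[ℂ] F} (h : ∀ w, T (monomial w) = S (monomial w)) : T = S := by
  ext f
  have hT := (hasSum_monomial f).mapL T
  have hS := (hasSum_monomial f).mapL S
  simp only [map_smul, h] at hT hS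
  exact hT.unique hS

/-- The isometry on the Fock space determined by an orthonormal family indexed by words. -/
noncomputable def isometryOf {v : Word ι → E} (hv : Orthonormal ℂ v) : NCHardy ι →ₗᵢ[ℂ] E :=
  hv.orthogonalFamily.linearIsometry

theorem isometryOf_monomial {v : Word ι → E} (hv : Orthonormal ℂ v) (w : Word ι) :
    isometryOf hv (monomial w) = v w := by
  classical
  rw [isometryOf, monomial, OrthogonalFamily.linearIsometry_apply_single]
  simp

/-- Right multiplication by the monomial `z^w`. -/
noncomputable def rightShift (w : Word ι) : NCHardy ι →ₗᵢ[ℂ] NCHardy ι :=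
  isometryOf (v := fun a => monomial (a ++ w))
    (orthonormal_monomial.comp _ (List.append_left_injective w))

theorem rightShift_monomial (w a : Word ι) : rightShift w (monomial a) = monomial (a ++ w) :=
  isometryOf_monomial _ a

theorem rightShift_apply_append (w γ : Word ι) (f : NCHardy ι) :
    rightShift w f (γ ++ w) = f γ := by
  rw [← inner_monomial_left, ← rightShift_monomial, LinearIsometry.inner_map_map,
    inner_monomial_left]

theorem rightShift_apply_of_not_suffix {w γ : Word ι} (h : ¬ w <:+ γ) (f : NCHardy ι) :
    rightShift w f γ = 0 := by
  have : (innerSL ℂ (monomial γ)).comp (rightShift w).toContinuousLinearMap = 0 := by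
    refine ext_monomial fun a => ?_
    simp only [ContinuousLinearMap.comp_apply, LinearIsometry.coe_toContinuousLinearMap,
      rightShift_monomial, innerSL_apply_apply, inner_monomial_left, monomial_apply,
      zero_apply]
    rw [if_neg]
    rintro rfl
    exact h (List.suffix_append _ _)
  simpa [inner_monomial_left] using DFunLike.congr_fun this f

theorem rightShift_append (a w : Word ι) (f : NCHardy ι) :
    rightShift (a ++ w) f = rightShift w (rightShift a f) := by
  have : (rightShift (a ++ w)).toContinuousLinearMap =
      (rightShift w).toContinuousLinearMap ∘L (rightShift a).toContinuousLinearMap :=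
    ext_monomial fun b => by simp [rightShift_monomial]
  exact DFunLike.congr_fun this f

theorem rightShift_nil (f : NCHardy ι) : rightShift [] f = f := by
  ext γ
  simpa using rightShift_apply_append [] γ f

theorem leftShift_apply (k : ι) (f : NCHardy ι) (γ : Word ι) :
    leftShift k f γ = shiftCoeff k f γ := rfl

theorem leftShift_monomial (k : ι) (a : Word ι) :
    leftShift k (monomial a) = monomial (k :: a) := by
  ext γ
  rw [leftShift_apply, monomial_apply]
  rcases γ with _ | ⟨j, β⟩
  · simp [shiftCoeff]
  · by_cases h : j = k <;> by_cases h2 : β = a <;> simp [shiftCoeff, h, h2, monomial_apply]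

/-! ### Left multipliers -/

theorem cauchyProduct_monomial_append (φ : Word ι → ℂ) (w γ : Word ι) :
    cauchyProduct φ (monomial w) (γ ++ w) = φ γ := by
  rw [cauchyProduct, Finset.sum_eq_single γ.length]
  · simp [monomial_apply]
  · intro i hi hne
    have : (γ ++ w).drop i ≠ w := by
      intro h
      have h2 := congrArg List.length h
      simp at h2
      simp at hi
      omega
    simp [monomial_apply, this]
  · simp

theorem cauchyProduct_monomial_of_not_suffix (φ : Word ι → ℂ) {w γ : Word ι} (h : ¬ w <:+ γ) :
    cauchyProduct φ (monomial w) γ = 0 := by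
  refine Finset.sum_eq_zero fun i _ => ?_
  rw [monomial_apply, if_neg, mul_zero]
  intro h2
  exact h (h2 ▸ List.drop_suffix i γ)

theorem cauchyProduct_monomial (φ : NCHardy ι) (w γ : Word ι) :
    cauchyProduct φ (monomial w) γ = rightShift w φ γ := by
  by_cases h : w <:+ γ
  · obtain ⟨a, rfl⟩ := h
    rw [cauchyProduct_monomial_append, rightShift_apply_append]
  · rw [cauchyProduct_monomial_of_not_suffix φ h, rightShift_apply_of_not_suffix h]

theorem apply_eq_cauchyProduct {T : NCHardy ι →L[ℂ] NCHardy ι}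
    (hT : ∀ w, T (monomial w) = rightShift w (T (monomial []))) (f : NCHardy ι) (γ : Word ι) :
    T f γ = cauchyProduct (T (monomial [])) f γ := by
  have : (innerSL ℂ (monomial γ)).comp T = ∑ i ∈ Finset.range (γ.length + 1),
      (T (monomial []) (γ.take i)) • innerSL ℂ (monomial (γ.drop i)) := by
    refine ext_monomial fun a => ?_
    simp only [ContinuousLinearMap.comp_apply, hT a, innerSL_apply_apply, inner_monomial_left,
      ← cauchyProduct_monomial, sum_apply, smul_apply,
      smul_eq_mul]
    rfl
  simpa [inner_monomial_left, cauchyProduct] using DFunLike.congr_fun this f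

theorem isLeftMultiplier_iff {T : NCHardy ι →L[ℂ] NCHardy ι} :
    IsLeftMultiplier T ↔ ∀ w, T (monomial w) = rightShift w (T (monomial [])) := by
  refine ⟨?_, fun h => ⟨_, apply_eq_cauchyProduct h⟩⟩
  rintro ⟨φ, hφ⟩ w
  have h1 : φ = T (monomial []) := by
    ext γ
    simpa [hφ] using (cauchyProduct_monomial_append φ [] γ).symm
  ext γ
  rw [hφ, ← cauchyProduct_monomial, ← h1]

/-- Left and right multiplications commute, and monomials span a dense subspace. In this form the
condition is visibly stable under products and limits. -/
theorem isLeftMultiplier_iff_commute {T : NCHardy ι →L[ℂ] NCHardy ι} :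
    IsLeftMultiplier T ↔ ∀ w f, T (rightShift w f) = rightShift w (T f) := by
  rw [isLeftMultiplier_iff]
  refine ⟨fun h w f => ?_, fun h w => ?_⟩
  · have : T ∘L (rightShift w).toContinuousLinearMap =
        (rightShift w).toContinuousLinearMap ∘L T := by
      refine ext_monomial fun a => ?_
      simp only [ContinuousLinearMap.comp_apply, LinearIsometry.coe_toContinuousLinearMap,
        rightShift_monomial, h (a ++ w), h a, rightShift_append]
    exact DFunLike.congr_fun this f
  · rw [← h, rightShift_monomial, List.nil_append]

/-- Take shortest words `α`, `β` in the supports of the two factors. Any cut of `αβ` other than the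
obvious one has a prefix shorter than `α` or a suffix shorter than `β`, so the product has
coefficient `φ α * f β ≠ 0` there. -/
theorem IsLeftMultiplier.eq_zero_or_eq_zero {T : NCHardy ι →L[ℂ] NCHardy ι}
    (hT : IsLeftMultiplier T) {f : NCHardy ι} (h : T f = 0) : T = 0 ∨ f = 0 := by
  classical
  by_contra! hne
  obtain ⟨φ, hφ⟩ := hT
  have exists_min : ∀ ψ : Word ι → ℂ, (∃ α, ψ α ≠ 0) →
      ∃ α, ψ α ≠ 0 ∧ ∀ β, β.length < α.length → ψ β = 0 := by
    rintro ψ ⟨α, hα⟩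
    have hex : ∃ n, ∃ α, α.length = n ∧ ψ α ≠ 0 := ⟨_, α, rfl, hα⟩
    obtain ⟨α', hl, hα'⟩ := Nat.find_spec hex
    refine ⟨α', hα', fun β hβ => ?_⟩
    by_contra hβ'
    exact Nat.find_min hex (hl ▸ hβ) ⟨β, rfl, hβ'⟩
  have hφ0 : ∃ α, φ α ≠ 0 := by
    by_contra! h0
    apply hne.1
    ext g γ
    simp [hφ, cauchyProduct, h0]
  have hf0 : ∃ α, f α ≠ 0 := by
    by_contra! h0
    apply hne.2
    ext γ
    simp [h0]
  obtain ⟨α, hα, hαm⟩ := exists_min φ hφ0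
  obtain ⟨β, hβ, hβm⟩ := exists_min f hf0
  have h1 : T f (α ++ β) = φ α * f β := by
    rw [hφ, cauchyProduct, Finset.sum_eq_single α.length]
    · simp
    · intro i hi hne
      simp at hi
      rcases lt_or_gt_of_ne hne with hlt | hgt
      · rw [hαm _ (by simp; omega), zero_mul]
      · rw [hβm _ (by simp; omega), mul_zero]
    · simp
  rw [h] at h1
  simp at h1
  tauto

theorem IsLeftMultiplier.mul {T S : NCHardy ι →L[ℂ] NCHardy ι} (hT : IsLeftMultiplier T)
    (hS : IsLeftMultiplier S) : IsLeftMultiplier (T * S) := by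
  rw [isLeftMultiplier_iff_commute] at *
  intro w f
  simp [hT, hS]

theorem isLeftMultiplier_one : IsLeftMultiplier (1 : NCHardy ι →L[ℂ] NCHardy ι) :=
  isLeftMultiplier_iff_commute.2 fun _ _ => rfl

/-- The algebra of all left multipliers. -/
noncomputable def leftMultipliers (ι : Type*) : Subalgebra ℂ (NCHardy ι →L[ℂ] NCHardy ι) where
  carrier := {T | IsLeftMultiplier T}
  mul_mem' := IsLeftMultiplier.mul
  add_mem' {T S} hT hS := by
    simp only [Set.mem_ofPred_eq, isLeftMultiplier_iff_commute] at *
    intro w f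
    simp [hT, hS]
  algebraMap_mem' c := by
    simp only [Set.mem_ofPred_eq, isLeftMultiplier_iff_commute]
    intro w f
    simp [Algebra.algebraMap_eq_smul_one]

theorem leftShift_mem_leftMultipliers (k : ι) :
    (leftShift k).toContinuousLinearMap ∈ leftMultipliers ι :=
  isLeftMultiplier_iff.2 fun w => by
    simp [leftShift_monomial, rightShift_monomial]

theorem diskAlgebra_le_leftMultipliers : diskAlgebra ι ≤ leftMultipliers ι := by
  refine Subalgebra.topologicalClosure_minimal
    (Algebra.adjoin_le ?_) ?_
  · rintro _ ⟨k, rfl⟩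
    exact leftShift_mem_leftMultipliers k
  · have : (leftMultipliers ι : Set (NCHardy ι →L[ℂ] NCHardy ι)) =
        ⋂ (w : Word ι) (f : NCHardy ι), {T | T (rightShift w f) = rightShift w (T f)} := by
      ext T
      simp only [Set.mem_iInter]
      exact isLeftMultiplier_iff_commute
    rw [this]
    refine isClosed_iInter fun w => isClosed_iInter fun f => isClosed_eq ?_ ?_
    · fun_prop
    · exact (rightShift w).continuous.comp (by fun_prop)


/-! ### Evaluation at strict row contractions -/

theorem sum_norm_adjoint_sq_le {Z : ι → E →L[ℂ] E} {r : ℝ} {s : Finset ι}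
    (h : ‖∑ k ∈ s, Z k ∘L ContinuousLinearMap.adjoint (Z k)‖ ≤ r) (y : E) :
    ∑ k ∈ s, ‖ContinuousLinearMap.adjoint (Z k) y‖ ^ 2 ≤ r * ‖y‖ ^ 2 := by
  have h1 : ((∑ k ∈ s, ‖ContinuousLinearMap.adjoint (Z k) y‖ ^ 2 : ℝ) : ℂ) =
      inner ℂ y ((∑ k ∈ s, Z k ∘L ContinuousLinearMap.adjoint (Z k)) y) := by
    rw [sum_apply, inner_sum]
    push_cast
    refine Finset.sum_congr rfl fun k _ => ?_
    rw [Function.comp_apply, ← ContinuousLinearMap.adjoint_inner_left,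
      inner_self_eq_norm_sq_to_K]
    rfl
  have h2 := norm_inner_le_norm (𝕜 := ℂ) y
    ((∑ k ∈ s, Z k ∘L ContinuousLinearMap.adjoint (Z k)) y)
  rw [← h1, Complex.norm_real] at h2
  have h3 := ContinuousLinearMap.le_of_opNorm_le _ h y
  calc _ ≤ _ := le_abs_self _
    _ ≤ _ := h2
    _ ≤ ‖y‖ * (r * ‖y‖) := by gcongr
    _ = _ := by ring

/-- The adjoint lets the first letter act on `y` first. Peeling it off costs a factor `r`, and the
constant `(1 - r)⁻¹` is the fixed point of `c = 1 + r * c`. -/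
theorem sum_norm_adjoint_prod_sq_le {Z : ι → E →L[ℂ] E} {r : ℝ} (hr : r < 1)
    (h : ∀ s : Finset ι, ‖∑ k ∈ s, Z k ∘L ContinuousLinearMap.adjoint (Z k)‖ ≤ r)
    (A : Finset (Word ι)) (y : E) :
    ∑ α ∈ A, ‖ContinuousLinearMap.adjoint (α.map Z).prod y‖ ^ 2 ≤ (1 - r)⁻¹ * ‖y‖ ^ 2 := by
  classical
  have h1r : 0 < 1 - r := by linarith
  suffices key : ∀ (n : ℕ) (A : Finset (Word ι)), (∀ α ∈ A, α.length < n) → ∀ y : E,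
      ∑ α ∈ A, ‖ContinuousLinearMap.adjoint (α.map Z).prod y‖ ^ 2 ≤ (1 - r)⁻¹ * ‖y‖ ^ 2 from
    key (A.sup List.length + 1) A (fun α hα => Nat.lt_succ_of_le (Finset.le_sup hα)) y
  intro n
  induction n with
  | zero =>
    intro A hA y
    have : A = ∅ := Finset.eq_empty_of_forall_notMem fun α hα => by simpa using hA α hα
    subst this
    simp
    positivity
  | succ n ih =>
    intro A hA y
    let s : Finset ι := A.biUnion fun α => α.head?.toFinset
    let B : Finset (Word ι) := (A.image List.tail).filter fun β => β.length < n
    -- Enlarging `A` to the empty word and a full product of first letters and shorter tails turns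
    -- the sum into an iterated one.
    have hsub : A ⊆ insert [] ((s ×ˢ B).image fun p => p.1 :: p.2) := by
      intro α hα
      rcases α with _ | ⟨k, β⟩
      · simp
      · refine Finset.mem_insert_of_mem (Finset.mem_image.2 ⟨(k, β), ?_, rfl⟩)
        have hl := hA _ hα
        simp only [List.length_cons, add_lt_add_iff_right] at hl
        simp only [Finset.mem_product, s, B, Finset.mem_biUnion, Finset.mem_filter,
          Finset.mem_image]
        exact ⟨⟨_, hα, by simp⟩, ⟨_, hα, rfl⟩, hl⟩
    have hinj : Function.Injective fun p : ι × Word ι => p.1 :: p.2 := by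
      rintro ⟨a, b⟩ ⟨c, d⟩ h
      simpa using h
    calc _ ≤ ∑ α ∈ insert [] ((s ×ˢ B).image fun p => p.1 :: p.2),
          ‖ContinuousLinearMap.adjoint (α.map Z).prod y‖ ^ 2 :=
          Finset.sum_le_sum_of_subset_of_nonneg hsub fun _ _ _ => by positivity
      _ = ‖y‖ ^ 2 + ∑ k ∈ s, ∑ β ∈ B, ‖ContinuousLinearMap.adjoint (β.map Z).prod
            (ContinuousLinearMap.adjoint (Z k) y)‖ ^ 2 := by
          rw [Finset.sum_insert (by simp), Finset.sum_image hinj.injOn, Finset.sum_product]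
          congr 1
          · rw [List.map_nil, List.prod_nil, ← ContinuousLinearMap.star_eq_adjoint, star_one,
              one_apply_eq_self]
          · refine Finset.sum_congr rfl fun k _ => Finset.sum_congr rfl fun β _ => ?_
            rw [List.map_cons, List.prod_cons, ContinuousLinearMap.mul_def,
              ContinuousLinearMap.adjoint_comp, ContinuousLinearMap.comp_apply]
      _ ≤ ‖y‖ ^ 2 + ∑ k ∈ s, (1 - r)⁻¹ * ‖ContinuousLinearMap.adjoint (Z k) y‖ ^ 2 := by
          gcongr with k _
          exact ih B (fun α hα => (Finset.mem_filter.1 hα).2) _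
      _ ≤ ‖y‖ ^ 2 + (1 - r)⁻¹ * (r * ‖y‖ ^ 2) := by
          rw [← Finset.mul_sum]
          gcongr
          exact sum_norm_adjoint_sq_le (h s) y
      _ = (1 - r)⁻¹ * ‖y‖ ^ 2 := by
          field_simp
          ring

theorem IsStrictRowContraction.exists_bound {Z : ι → E →L[ℂ] E} (hZ : IsStrictRowContraction Z) :
    ∃ C : ℝ, 0 ≤ C ∧ ∀ (A : Finset (Word ι)) (f : NCHardy ι),
      ‖∑ α ∈ A, f α • (α.map Z).prod‖ ≤ C * √(∑ α ∈ A, ‖f α‖ ^ 2) := by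
  obtain ⟨r, hr, h⟩ := hZ
  have hr0 : 0 ≤ r := by simpa using h ∅
  have h1r : 0 < 1 - r := by linarith
  refine ⟨√(1 - r)⁻¹, Real.sqrt_nonneg _, fun A f => ?_⟩
  refine ContinuousLinearMap.opNorm_le_of_re_inner_le (𝕜 := ℂ) (by positivity) fun x y hx hy => ?_
  refine (RCLike.re_le_norm _).trans ?_
  rw [sum_apply, sum_inner]
  calc _ ≤ ∑ α ∈ A, ‖f α‖ * (‖x‖ * ‖ContinuousLinearMap.adjoint (α.map Z).prod y‖) := by
        refine (norm_sum_le _ _).trans (Finset.sum_le_sum fun α _ => ?_)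
        rw [smul_apply, inner_smul_left, norm_mul, RCLike.norm_conj,
          ← ContinuousLinearMap.adjoint_inner_right]
        gcongr
        exact norm_inner_le_norm _ _
    _ = ‖x‖ * ∑ α ∈ A, ‖f α‖ * ‖ContinuousLinearMap.adjoint (α.map Z).prod y‖ := by
        rw [Finset.mul_sum]
        refine Finset.sum_congr rfl fun α _ => ?_
        ring
    _ ≤ ‖x‖ * (√(∑ α ∈ A, ‖f α‖ ^ 2) *
          √(∑ α ∈ A, ‖ContinuousLinearMap.adjoint (α.map Z).prod y‖ ^ 2)) := by
        gcongr
        exact Real.sum_mul_le_sqrt_mul_sqrt _ _ _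
    _ ≤ ‖x‖ * (√(∑ α ∈ A, ‖f α‖ ^ 2) * √((1 - r)⁻¹ * ‖y‖ ^ 2)) := by
        gcongr
        exact sum_norm_adjoint_prod_sq_le hr h A y
    _ = _ := by
        rw [hx, hy, Real.sqrt_mul (by positivity)]
        simp [mul_comm]

theorem hasSum_norm_sq (f : NCHardy ι) : HasSum (fun γ => ‖f γ‖ ^ 2) (‖f‖ ^ 2) := by
  simpa using lp.hasSum_norm (p := 2) (by norm_num) f

theorem IsStrictRowContraction.summable {Z : ι → E →L[ℂ] E} (hZ : IsStrictRowContraction Z)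
    (f : NCHardy ι) : Summable fun α : Word ι => f α • (α.map Z).prod := by
  obtain ⟨C, hC0, hC⟩ := hZ.exists_bound
  rw [summable_iff_vanishing_norm]
  intro ε hε
  obtain ⟨s, hs⟩ := summable_iff_vanishing_norm.1 (hasSum_norm_sq f).summable
    ((ε / (C + 1)) ^ 2) (by positivity)
  refine ⟨s, fun t ht => (hC t f).trans_lt ?_⟩
  have h1 := hs t ht
  rw [Real.norm_of_nonneg (by positivity)] at h1
  have h2 : √(∑ α ∈ t, ‖f α‖ ^ 2) ≤ ε / (C + 1) := by
    rw [Real.sqrt_le_left (by positivity)]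
    exact h1.le
  calc _ ≤ C * (ε / (C + 1)) := by gcongr
    _ < (C + 1) * (ε / (C + 1)) := by
      gcongr
      linarith
    _ = ε := by field_simp

theorem IsStrictRowContraction.exists_norm_eval_le {Z : ι → E →L[ℂ] E}
    (hZ : IsStrictRowContraction Z) : ∃ C : ℝ, ∀ f : NCHardy ι, ‖eval f Z‖ ≤ C * ‖f‖ := by
  obtain ⟨C, hC0, hC⟩ := hZ.exists_bound
  refine ⟨C, fun f => le_of_tendsto (hZ.summable f).hasSum.norm (.of_forall fun A => ?_)⟩
  refine (hC A f).trans ?_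
  gcongr
  rw [Real.sqrt_le_left (norm_nonneg f)]
  exact sum_le_hasSum A (fun _ _ => by positivity) (hasSum_norm_sq f)

/-- Evaluation at a strict row contraction, as a bounded linear map. -/
noncomputable def IsStrictRowContraction.evalCLM {Z : ι → E →L[ℂ] E}
    (hZ : IsStrictRowContraction Z) : NCHardy ι →L[ℂ] (E →L[ℂ] E) :=
  LinearMap.mkContinuousOfExistsBound
    { toFun := fun f => eval f Z
      map_add' := fun f g => by
        simp only [eval, lp.coeFn_add, Pi.add_apply, add_smul]
        exact (hZ.summable f).tsum_add (hZ.summable g)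
      map_smul' := fun c f => by
        simp only [eval, lp.coeFn_smul, Pi.smul_apply, smul_eq_mul, mul_smul, RingHom.id_apply]
        exact (hZ.summable f).tsum_const_smul c }
    hZ.exists_norm_eval_le

theorem IsStrictRowContraction.evalCLM_apply {Z : ι → E →L[ℂ] E}
    (hZ : IsStrictRowContraction Z) (f : NCHardy ι) : hZ.evalCLM f = eval f Z := rfl

theorem eval_monomial {F : Type*} [NormedAddCommGroup F] [InnerProductSpace ℂ F]
    (Z : ι → F →L[ℂ] F) (w : Word ι) : eval (monomial w) Z = (w.map Z).prod := by
  rw [eval, tsum_eq_single w fun α hα => by simp [monomial_apply, hα]]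
  simp [monomial_apply]

theorem IsStrictRowContraction.eval_rightShift {Z : ι → E →L[ℂ] E}
    (hZ : IsStrictRowContraction Z) (w : Word ι) (f : NCHardy ι) :
    eval (rightShift w f) Z = eval f Z * (w.map Z).prod := by
  have : hZ.evalCLM ∘L (rightShift w).toContinuousLinearMap =
      (ContinuousLinearMap.mul ℂ (E →L[ℂ] E)).flip (w.map Z).prod ∘L hZ.evalCLM :=
    ext_monomial fun a => by
      simp [IsStrictRowContraction.evalCLM_apply, rightShift_monomial, eval_monomial]
  exact DFunLike.congr_fun this f

/-- Both sides are continuous and linear in `f`, so monomials suffice; there `T` acts as a right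
shift of its symbol. -/
theorem IsStrictRowContraction.eval_mul {Z : ι → E →L[ℂ] E} (hZ : IsStrictRowContraction Z)
    {T : NCHardy ι →L[ℂ] NCHardy ι} (hT : IsLeftMultiplier T) (f : NCHardy ι) :
    eval (T f) Z = eval (T (vacuum ι)) Z * eval f Z := by
  have : hZ.evalCLM ∘L T =
      (ContinuousLinearMap.mul ℂ (E →L[ℂ] E)) (eval (T (vacuum ι)) Z) ∘L hZ.evalCLM :=
    ext_monomial fun w => by
      rw [ContinuousLinearMap.comp_apply, isLeftMultiplier_iff.1 hT w, hZ.evalCLM_apply,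
        hZ.eval_rightShift]
      simp [IsStrictRowContraction.evalCLM_apply, eval_monomial, vacuum_eq_monomial]
  exact DFunLike.congr_fun this f

/-- Evaluation intertwines: an intertwiner of the tuples intertwines the values. -/
theorem comp_eval_eq {E' : Type*} [NormedAddCommGroup E'] [InnerProductSpace ℂ E']
    [CompleteSpace E'] {Z : ι → E →L[ℂ] E} {Z' : ι → E' →L[ℂ] E'}
    (hZ : IsStrictRowContraction Z) (hZ' : IsStrictRowContraction Z') {V : E' →L[ℂ] E}
    (hV : ∀ k, V ∘L Z' k = Z k ∘L V) (f : NCHardy ι) : V ∘L eval f Z' = eval f Z ∘L V := by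
  have : (ContinuousLinearMap.compL ℂ E' E' E V) ∘L hZ'.evalCLM =
      (ContinuousLinearMap.compL ℂ E' E E).flip V ∘L hZ.evalCLM := by
    refine ext_monomial fun w => ?_
    simp only [ContinuousLinearMap.comp_apply, ContinuousLinearMap.compL_apply,
      ContinuousLinearMap.flip_apply, IsStrictRowContraction.evalCLM_apply, eval_monomial]
    induction w with
    | nil => simp [ContinuousLinearMap.one_def]
    | cons k w ih =>
      simp only [List.map_cons, List.prod_cons, ContinuousLinearMap.mul_def]
      rw [← ContinuousLinearMap.comp_assoc, hV, ContinuousLinearMap.comp_assoc, ih,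
        ContinuousLinearMap.comp_assoc]
  exact DFunLike.congr_fun this f


/-! ### Dilations of elements of the disk algebra -/

/-- The left free shifts scaled by `z`. -/
noncomputable def scaledShift (ι : Type*) (z : ℂ) (k : ι) : NCHardy ι →L[ℂ] NCHardy ι :=
  z • (leftShift k).toContinuousLinearMap

theorem inner_leftShift_of_ne {i j : ι} (h : i ≠ j) (f g : NCHardy ι) :
    inner ℂ (leftShift i f) (leftShift j g) = 0 := by
  rw [lp.inner_eq_tsum]
  refine (tsum_congr fun γ => ?_).trans tsum_zero
  rw [leftShift_apply, leftShift_apply]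
  rcases γ with _ | ⟨k, β⟩
  · simp [shiftCoeff]
  · by_cases hi : k = i
    · simp [shiftCoeff, hi, h]
    · simp [shiftCoeff, hi]

theorem star_leftShift_mul (i j : ι) :
    star (leftShift i).toContinuousLinearMap * (leftShift j).toContinuousLinearMap =
    open scoped Classical in if i = j then 1 else 0 := by
  refine ContinuousLinearMap.ext fun f => ext_inner_left ℂ fun g => ?_
  rw [mul_apply_eq_comp, ContinuousLinearMap.star_eq_adjoint,
    ContinuousLinearMap.adjoint_inner_right]
  split_ifs with h
  · subst h
    simp
  · simp [inner_leftShift_of_ne h]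

/-- The left shifts have orthogonal ranges, so the sum of their range projections is a projection.
-/
theorem norm_sum_leftShift_adjoint_le (s : Finset ι) :
    ‖∑ k ∈ s, (leftShift k).toContinuousLinearMap ∘L
      ContinuousLinearMap.adjoint (leftShift k).toContinuousLinearMap‖ ≤ 1 := by
  classical
  change ‖∑ k ∈ s, (leftShift k).toContinuousLinearMap *
      star (leftShift k).toContinuousLinearMap‖ ≤ 1
  refine IsStarProjection.norm_le _ ⟨?_, ?_⟩
  · rw [IsIdempotentElem, Finset.sum_mul_sum]
    refine Finset.sum_congr rfl fun i hi => ?_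
    simp only [mul_assoc]
    simp only [← mul_assoc (star _), star_leftShift_mul]
    simp [hi]
  · simp [IsSelfAdjoint]

theorem isStrictRowContraction_scaledShift {z : ℂ} (hz : ‖z‖ < 1) :
    IsStrictRowContraction (scaledShift ι z) := by
  -- The computation gives `‖z‖ ^ 2`; the weaker bound `‖z‖` is already below `1`.
  refine ⟨‖z‖, hz, fun s => ?_⟩
  have : ∑ k ∈ s, scaledShift ι z k ∘L ContinuousLinearMap.adjoint (scaledShift ι z k) =
      (z * starRingEnd ℂ z) • ∑ k ∈ s, (leftShift k).toContinuousLinearMap ∘L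
        ContinuousLinearMap.adjoint (leftShift k).toContinuousLinearMap := by
    simp only [scaledShift, map_smulₛₗ, ContinuousLinearMap.smul_comp,
      ContinuousLinearMap.comp_smul, Finset.smul_sum, smul_smul, mul_comm]
  rw [this, norm_smul, norm_mul, RCLike.norm_conj]
  calc _ ≤ ‖z‖ * 1 * 1 := by
        gcongr
        exact norm_sum_leftShift_adjoint_le s
    _ = ‖z‖ := by ring

theorem prod_map_scaledShift_monomial (z : ℂ) (w a : Word ι) :
    (w.map (scaledShift ι z)).prod (monomial a) = z ^ w.length • monomial (w ++ a) := by
  induction w with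
  | nil => simp
  | cons k w ih =>
    rw [List.map_cons, List.prod_cons, mul_apply_eq_comp, ih]
    simp [scaledShift, leftShift_monomial, smul_smul, pow_succ]

theorem eval_scaledShift_vacuum_apply {z : ℂ} (hz : ‖z‖ < 1) (f : NCHardy ι) (w : Word ι) :
    eval f (scaledShift ι z) (vacuum ι) w = z ^ w.length * f w := by
  have hZ := isStrictRowContraction_scaledShift (ι := ι) hz
  have : (innerSL ℂ (monomial w)) ∘L
      (ContinuousLinearMap.apply ℂ (NCHardy ι) (vacuum ι)) ∘L hZ.evalCLM =
      z ^ w.length • innerSL ℂ (monomial w) := by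
    refine ext_monomial fun a => ?_
    simp only [ContinuousLinearMap.comp_apply, ContinuousLinearMap.apply_apply,
      hZ.evalCLM_apply, eval_monomial, vacuum_eq_monomial, prod_map_scaledShift_monomial,
      List.append_nil, innerSL_apply_apply, inner_monomial_left, smul_apply, lp.coeFn_smul,
      Pi.smul_apply, monomial_apply, smul_eq_mul]
    split_ifs with h
    · rw [h]
    · simp
  simpa [inner_monomial_left, hZ.evalCLM_apply] using DFunLike.congr_fun this f

/-! ### Gauge unitaries and norm convergence of dilations -/

/-- The gauge unitary multiplying `z^w` by `u ^ |w|`. -/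
noncomputable def gauge (ι : Type*) {u : ℂ} (hu : ‖u‖ = 1) : NCHardy ι →ₗᵢ[ℂ] NCHardy ι :=
  isometryOf (v := fun w => u ^ w.length • monomial w) <| by
    classical
    rw [orthonormal_iff_ite]
    intro i j
    rw [inner_smul_left, inner_smul_right, inner_monomial_left, monomial_apply]
    split_ifs with h
    · subst h
      rw [mul_one, RCLike.conj_mul]
      simp [hu]
    · simp

theorem gauge_monomial {u : ℂ} (hu : ‖u‖ = 1) (w : Word ι) :
    gauge ι hu (monomial w) = u ^ w.length • monomial w :=
  isometryOf_monomial _ w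

theorem gauge_leftShift {u : ℂ} (hu : ‖u‖ = 1) (k : ι) (f : NCHardy ι) :
    gauge ι hu (leftShift k f) = u • leftShift k (gauge ι hu f) := by
  have : (gauge ι hu).toContinuousLinearMap ∘L (leftShift k).toContinuousLinearMap =
      u • ((leftShift k).toContinuousLinearMap ∘L (gauge ι hu).toContinuousLinearMap) :=
    ext_monomial fun w => by
      simp [leftShift_monomial, gauge_monomial, smul_smul, pow_succ']
  exact DFunLike.congr_fun this f

theorem gauge_surjective {u : ℂ} (hu : ‖u‖ = 1) : Function.Surjective (gauge ι hu) := by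
  have hu' : ‖u⁻¹‖ = 1 := by simp [hu]
  have hu0 : u ≠ 0 := by
    rintro rfl
    simp at hu
  have : (gauge ι hu).toContinuousLinearMap ∘L (gauge ι hu').toContinuousLinearMap = 1 :=
    ext_monomial fun w => by
      simp [gauge_monomial, smul_smul, hu0]
  exact fun f => ⟨gauge ι hu' f, DFunLike.congr_fun this f⟩

/-- A polynomial in the left free shifts extends to an entire family of dilations. -/
theorem exists_differentiable_dilation {p : NCHardy ι →L[ℂ] NCHardy ι}
    (hp : p ∈ Algebra.adjoin ℂ (Set.range fun k : ι => (leftShift k).toContinuousLinearMap)) :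
    ∃ P : ℂ → NCHardy ι →L[ℂ] NCHardy ι, Differentiable ℂ P ∧ P 1 = p ∧
      (∀ z, ‖z‖ < 1 → P z = eval (p (vacuum ι)) (scaledShift ι z)) ∧
      ∀ u (hu : ‖u‖ = 1) f, P u (gauge ι hu f) = gauge ι hu (p f) := by
  induction hp using Algebra.adjoin_induction with
  | mem x hx =>
    obtain ⟨k, rfl⟩ := hx
    refine ⟨fun z => scaledShift ι z k, ?_, ?_, fun z hz => ?_, fun u hu f => ?_⟩
    · exact differentiable_id.smul_const _
    · simp [scaledShift]
    · simp [vacuum_eq_monomial, leftShift_monomial, eval_monomial]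
    · simp [scaledShift, gauge_leftShift]
  | algebraMap c =>
    refine ⟨fun _ => algebraMap ℂ _ c, differentiable_const _, rfl, fun z hz => ?_, ?_⟩
    · rw [Algebra.algebraMap_eq_smul_one, smul_apply, one_apply_eq_self,
        ← (isStrictRowContraction_scaledShift hz).evalCLM_apply, map_smul,
        (isStrictRowContraction_scaledShift hz).evalCLM_apply, vacuum_eq_monomial, eval_monomial]
      simp
    · intro u hu f
      simp [Algebra.algebraMap_eq_smul_one]
  | add x y _ _ hx hy =>
    obtain ⟨P, hPd, hP1, hPe, hPg⟩ := hx
    obtain ⟨Q, hQd, hQ1, hQe, hQg⟩ := hy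
    refine ⟨fun z => P z + Q z, hPd.add hQd, by simp only [hP1, hQ1], fun z hz => ?_, ?_⟩
    · simp only [hPe z hz, hQe z hz]
      rw [add_apply,
        ← (isStrictRowContraction_scaledShift hz).evalCLM_apply (_ + _), map_add]
      rfl
    · intro u hu f
      simp [hPg u hu, hQg u hu]
  | mul x y hx' _ hx hy =>
    obtain ⟨P, hPd, hP1, hPe, hPg⟩ := hx
    obtain ⟨Q, hQd, hQ1, hQe, hQg⟩ := hy
    refine ⟨fun z => P z * Q z, hPd.mul hQd, by simp only [hP1, hQ1], fun z hz => ?_, ?_⟩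
    · simp only [hPe z hz, hQe z hz]
      rw [mul_apply_eq_comp,
        (isStrictRowContraction_scaledShift hz).eval_mul (f := y _)
          (diskAlgebra_le_leftMultipliers (Subalgebra.le_topologicalClosure _ hx'))]
    · intro u hu f
      simp [hPg u hu, hQg u hu]

open Filter Topology

/-- Dilation by `z` is norm decreasing on polynomials, by the maximum modulus principle. -/
theorem norm_eval_scaledShift_le_of_mem_adjoin {p : NCHardy ι →L[ℂ] NCHardy ι}
    (hp : p ∈ Algebra.adjoin ℂ (Set.range fun k : ι => (leftShift k).toContinuousLinearMap))
    {z : ℂ} (hz : ‖z‖ < 1) : ‖eval (p (vacuum ι)) (scaledShift ι z)‖ ≤ ‖p‖ := by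
  obtain ⟨P, hPd, -, hPe, hPg⟩ := exists_differentiable_dilation hp
  rw [← hPe z hz]
  refine Complex.norm_le_of_forall_mem_frontier_norm_le (U := Metric.ball 0 1)
    Metric.isBounded_ball hPd.diffContOnCl (fun u hu => ?_) (subset_closure (by simpa using hz))
  have hu1 : ‖u‖ = 1 := by simpa [frontier_ball] using hu
  -- On the unit circle `P u` is the conjugate of `p` by a gauge unitary.
  refine ContinuousLinearMap.opNorm_le_bound _ (norm_nonneg p) fun f => ?_
  obtain ⟨g, rfl⟩ := gauge_surjective hu1 f
  rw [hPg u hu1, LinearIsometry.norm_map, LinearIsometry.norm_map]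
  exact p.le_opNorm g

theorem norm_eval_scaledShift_le {T : NCHardy ι →L[ℂ] NCHardy ι} (hT : T ∈ diskAlgebra ι)
    {z : ℂ} (hz : ‖z‖ < 1) : ‖eval (T (vacuum ι)) (scaledShift ι z)‖ ≤ ‖T‖ := by
  refine closure_minimal (t := {T : NCHardy ι →L[ℂ] NCHardy ι |
    ‖eval (T (vacuum ι)) (scaledShift ι z)‖ ≤ ‖T‖})
    (fun p hp => norm_eval_scaledShift_le_of_mem_adjoin hp hz) (isClosed_le ?_ continuous_norm) hT
  simp only [← (isStrictRowContraction_scaledShift hz).evalCLM_apply]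
  fun_prop

theorem eventually_norm_ofReal_lt_one : ∀ᶠ r : ℝ in 𝓝[<] 1, ‖(r : ℂ)‖ < 1 := by
  filter_upwards [Ioo_mem_nhdsLT (show (0 : ℝ) < 1 by norm_num)] with r hr
  rw [Complex.norm_real, Real.norm_of_nonneg hr.1.le]
  exact hr.2

/-- The dilations of an element of the disk algebra converge to it in operator norm. -/
theorem tendsto_eval_scaledShift {T : NCHardy ι →L[ℂ] NCHardy ι} (hT : T ∈ diskAlgebra ι) :
    Tendsto (fun r : ℝ => eval (T (vacuum ι)) (scaledShift ι (r : ℂ))) (𝓝[<] 1) (𝓝 T) := by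
  rw [Metric.tendsto_nhds]
  intro ε hε
  obtain ⟨p, hp, hTp⟩ := Metric.mem_closure_iff.1 hT (ε / 3) (by positivity)
  have hp' : p ∈ diskAlgebra ι := Subalgebra.le_topologicalClosure _ hp
  obtain ⟨P, hPd, hP1, hPe, -⟩ := exists_differentiable_dilation hp
  have hPt : Tendsto (fun r : ℝ => P (r : ℂ)) (𝓝[<] 1) (𝓝 p) := by
    have h := (hPd.continuous.comp Complex.continuous_ofReal).tendsto 1
    simp only [Function.comp_apply, Complex.ofReal_one, hP1] at h
    exact h.mono_left nhdsWithin_le_nhds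
  filter_upwards [eventually_norm_ofReal_lt_one,
    Metric.tendsto_nhds.1 hPt (ε / 3) (by positivity)] with r hr hrp
  -- Contractivity of dilation on `T - p` makes the approximation error uniform in `r`.
  have h1 := norm_eval_scaledShift_le (sub_mem hT hp') hr
  have hZ := isStrictRowContraction_scaledShift (ι := ι) hr
  rw [sub_apply, ← hZ.evalCLM_apply, map_sub, hZ.evalCLM_apply, hZ.evalCLM_apply,
    ← hPe _ hr, ← dist_eq_norm, ← dist_eq_norm] at h1
  calc _ ≤ _ + _ + _ := dist_triangle4 _ (P r) p T
    _ < ε / 3 + ε / 3 + ε / 3 := by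
      gcongr
      · exact h1.trans_lt hTp
      · rwa [dist_comm]
    _ = ε := by ring

theorem norm_eval_scaledShift_vacuum_le {z : ℂ} (hz : ‖z‖ < 1) (f : NCHardy ι) :
    ‖eval f (scaledShift ι z) (vacuum ι)‖ ≤ ‖f‖ := by
  have h1 := hasSum_norm_sq (eval f (scaledShift ι z) (vacuum ι))
  simp only [eval_scaledShift_vacuum_apply hz] at h1
  have h2 := hasSum_le (fun w => ?_) h1 (hasSum_norm_sq f)
  · exact (sq_le_sq₀ (norm_nonneg _) (norm_nonneg _)).1 h2
  · rw [norm_mul, norm_pow]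
    gcongr
    exact mul_le_of_le_one_left (norm_nonneg _) (pow_le_one₀ (norm_nonneg _) hz.le)

theorem tendsto_eval_scaledShift_vacuum (f : NCHardy ι) :
    Tendsto (fun r : ℝ => eval f (scaledShift ι (r : ℂ)) (vacuum ι)) (𝓝[<] 1) (𝓝 f) := by
  rw [tendsto_iff_norm_sub_tendsto_zero]
  have h : Tendsto (fun r : ℝ => ∑' w : Word ι, ‖((r : ℂ) ^ w.length - 1) * f w‖ ^ 2)
      (𝓝[<] 1) (𝓝 (∑' w : Word ι, (0 : ℝ))) := by
    -- The constant is `2 ^ 2`, from `‖r ^ n - 1‖ ≤ 2`.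
    refine tendsto_tsum_of_dominated_convergence (bound := fun w => 4 * ‖f w‖ ^ 2)
      ((hasSum_norm_sq f).summable.mul_left 4) (fun w => ?_) ?_
    · refine Tendsto.mono_left ?_ nhdsWithin_le_nhds
      have : Continuous fun r : ℝ => ‖((r : ℂ) ^ w.length - 1) * f w‖ ^ 2 := by fun_prop
      simpa using this.tendsto 1
    · filter_upwards [eventually_norm_ofReal_lt_one] with r hr w
      rw [Real.norm_of_nonneg (by positivity), norm_mul, mul_pow]
      gcongr
      have : ‖(r : ℂ) ^ w.length - 1‖ ≤ 1 + 1 := by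
        refine (norm_sub_le _ _).trans ?_
        rw [norm_pow, norm_one]
        gcongr
        exact pow_le_one₀ (norm_nonneg _) hr.le
      nlinarith [norm_nonneg ((r : ℂ) ^ w.length - 1)]
  rw [tsum_zero] at h
  have h2 := h.sqrt
  rw [Real.sqrt_zero] at h2
  refine h2.congr' ?_
  filter_upwards [eventually_norm_ofReal_lt_one] with r hr
  rw [← Real.sqrt_sq (norm_nonneg (eval f _ _ - f)), ← (hasSum_norm_sq _).tsum_eq]
  congr 1
  refine tsum_congr fun w => ?_
  rw [lp.coeFn_sub, Pi.sub_apply, eval_scaledShift_vacuum_apply hr, sub_mul, one_mul]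


/-! ### Singularity spaces of elements of the disk algebra with closed range -/

/-! ### Transport of tuples along isometries -/

section Transfer

variable {E' : Type*} [NormedAddCommGroup E'] [InnerProductSpace ℂ E'] [CompleteSpace E']

/-- This carries a tuple on the Fock space to `ℓ²(ℕ)`, where the singularity space is tested,
extending it by zero off the range of `U`. -/
theorem IsStrictRowContraction.conj_isometry {Z : ι → E →L[ℂ] E} (hZ : IsStrictRowContraction Z)
    (U : E →ₗᵢ[ℂ] E') :
    IsStrictRowContraction fun k => U.toContinuousLinearMap ∘L Z k ∘L
      ContinuousLinearMap.adjoint U.toContinuousLinearMap := by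
  obtain ⟨r, hr, h⟩ := hZ
  refine ⟨r, hr, fun s => ?_⟩
  have hr0 : 0 ≤ r := by simpa using h ∅
  have hU : ‖U.toContinuousLinearMap‖ ≤ 1 := U.norm_toContinuousLinearMap_le
  have key : ∑ k ∈ s, (U.toContinuousLinearMap ∘L Z k ∘L
      ContinuousLinearMap.adjoint U.toContinuousLinearMap) ∘L
        ContinuousLinearMap.adjoint (U.toContinuousLinearMap ∘L Z k ∘L
          ContinuousLinearMap.adjoint U.toContinuousLinearMap) =
      U.toContinuousLinearMap ∘L (∑ k ∈ s, Z k ∘L ContinuousLinearMap.adjoint (Z k)) ∘L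
        ContinuousLinearMap.adjoint U.toContinuousLinearMap := by
    ext x
    simp only [ContinuousLinearMap.adjoint_comp, ContinuousLinearMap.adjoint_adjoint, sum_apply,
      ContinuousLinearMap.comp_apply, map_sum]
    refine Finset.sum_congr rfl fun k _ => ?_
    congr 2
    exact DFunLike.congr_fun (U.adjoint_comp_self) _
  rw [key]
  calc _ ≤ 1 * (r * 1) := by
        refine (ContinuousLinearMap.opNorm_comp_le _ _).trans ?_
        refine mul_le_mul hU ?_ (norm_nonneg _) zero_le_one
        refine (ContinuousLinearMap.opNorm_comp_le _ _).trans ?_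
        refine mul_le_mul (h s) ?_ (norm_nonneg _) hr0
        rwa [LinearIsometryEquiv.norm_map]
    _ = r := by ring

/-- The adjoint `U*` intertwines `U Z_k U*` with `Z_k`. Using `U*` also handles constant terms when
`U` is not onto. -/
theorem inner_eval_conj_isometry {Z : ι → E →L[ℂ] E} (hZ : IsStrictRowContraction Z)
    (U : E →ₗᵢ[ℂ] E') (g : NCHardy ι) (y : E) (x : E') :
    inner ℂ (U y) (eval g (fun k => U.toContinuousLinearMap ∘L Z k ∘L
      ContinuousLinearMap.adjoint U.toContinuousLinearMap) x) =
    inner ℂ y (eval g Z (ContinuousLinearMap.adjoint U.toContinuousLinearMap x)) := by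
  have h := comp_eval_eq hZ (hZ.conj_isometry U)
    (V := ContinuousLinearMap.adjoint U.toContinuousLinearMap) (fun k => by
      rw [← ContinuousLinearMap.comp_assoc, U.adjoint_comp_self, ContinuousLinearMap.one_def,
        ContinuousLinearMap.id_comp]) g
  rw [← LinearIsometry.coe_toContinuousLinearMap, ← ContinuousLinearMap.adjoint_inner_right]
  exact congrArg _ (DFunLike.congr_fun h x)

end Transfer

/-- An embedding is enough, and it covers the empty alphabet, whose Fock space is one-dimensional.
-/
theorem exists_linearIsometry_lp_nat [Countable ι] :
    Nonempty (NCHardy ι →ₗᵢ[ℂ] lp (fun _ : ℕ => ℂ) 2) := by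
  obtain ⟨e, he⟩ := exists_injective_nat (Word ι)
  have h : Orthonormal ℂ fun n : ℕ => (lp.single 2 n 1 : lp (fun _ : ℕ => ℂ) 2) := by
    rw [orthonormal_iff_ite]
    intro i j
    rw [lp.inner_single_left]
    simp [lp.single_apply, Pi.single_apply]
  exact ⟨isometryOf (h.comp e he)⟩

/-- The defining property of the singularity space also holds for strict row contractions on the
Fock space itself. -/
theorem inner_eval_eq_zero_of_mem_singularitySpace [Countable ι] {h f : NCHardy ι}
    (hf : f ∈ singularitySpace h) {Z : ι → NCHardy ι →L[ℂ] NCHardy ι}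
    (hZ : IsStrictRowContraction Z) {y : NCHardy ι} (hy : ∀ x, inner ℂ y (eval h Z x) = 0)
    (x : NCHardy ι) : inner ℂ y (eval f Z x) = 0 := by
  obtain ⟨U⟩ := exists_linearIsometry_lp_nat (ι := ι)
  have h1 := (inner_eval_conj_isometry hZ U f y (U x)).symm.trans
    (hf.2 (_, U y) ⟨hZ.conj_isometry U, fun x => (inner_eval_conj_isometry hZ U h y x).trans
      (hy _)⟩ (U x))
  convert h1
  exact (DFunLike.congr_fun U.adjoint_comp_self x).symm

theorem mem_range_of_mem_singularitySpace [Countable ι] {H : NCHardy ι →L[ℂ] NCHardy ι}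
    (hH : H ∈ diskAlgebra ι) (hne : H ≠ 0) (hcl : IsClosed (Set.range H)) {f : NCHardy ι}
    (hf : f ∈ singularitySpace (H (vacuum ι))) : f ∈ Set.range H := by
  have hinj : Function.Injective H := (injective_iff_map_eq_zero H).2 fun g hg =>
    ((diskAlgebra_le_leftMultipliers hH).eq_zero_or_eq_zero hg).resolve_left hne
  obtain ⟨K, hK⟩ := H.antilipschitz_of_injective_of_isClosed_range hinj hcl
  have hbd : ∀ x, ‖x‖ ≤ K * ‖H x‖ := fun x => by simpa using hK.le_mul_dist x 0
  let D : ℝ → NCHardy ι →L[ℂ] NCHardy ι := fun r => eval (H (vacuum ι)) (scaledShift ι (r : ℂ))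
  have hD : Tendsto (fun r => ‖D r - H‖) (𝓝[<] 1) (𝓝 0) :=
    tendsto_iff_norm_sub_tendsto_zero.1 (tendsto_eval_scaledShift hH)
  have hg : ∀ᶠ r : ℝ in 𝓝[<] 1, ∃ g, D r g = eval f (scaledShift ι (r : ℂ)) (vacuum ι) ∧
      ‖g‖ ≤ 2 * K * ‖f‖ := by
    have hsmall : ∀ᶠ r : ℝ in 𝓝[<] 1, K * ‖D r - H‖ < 1 / 2 := by
      have := hD.const_mul (K : ℝ)
      rw [mul_zero] at this
      exact this.eventually_lt_const (by norm_num)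
    filter_upwards [eventually_norm_ofReal_lt_one, hsmall] with r hr hs
    have hZ := isStrictRowContraction_scaledShift (ι := ι) hr
    -- From `‖x‖ ≤ K * ‖H x‖ ≤ K * ‖D r x‖ + ‖x‖ / 2`, absorbing the last term.
    have hbd' : ∀ x, ‖x‖ ≤ 2 * K * ‖D r x‖ := fun x => by
      have h1 : ‖H x‖ ≤ ‖D r x‖ + ‖D r - H‖ * ‖x‖ := by
        calc ‖H x‖ = ‖D r x - (D r - H) x‖ := by simp
          _ ≤ ‖D r x‖ + ‖(D r - H) x‖ := norm_sub_le _ _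
          _ ≤ _ := by
            gcongr
            exact ContinuousLinearMap.le_opNorm _ _
      have h2 := mul_le_mul_of_nonneg_left h1 K.2
      have h3 := mul_le_mul_of_nonneg_right hs.le (norm_nonneg x)
      have h4 := hbd x
      change (K : ℝ) * _ ≤ (K : ℝ) * _ at h2
      nlinarith
    have hcl' : IsClosed (Set.range (D r)) := by
      refine AntilipschitzWith.isClosed_range (K := 2 * K) ?_ (D r).uniformContinuous
      exact AddMonoidHomClass.antilipschitz_of_bound (D r) (by simpa using hbd')
    -- A closed subspace is its double orthocomplement, and `y ⊥ ran (D r)` says exactly that `(rL,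
    -- y)` is in the left variety of `H`.
    have hmem : eval f (scaledShift ι (r : ℂ)) (vacuum ι) ∈ (D r).range := by
      have : CompleteSpace (D r).range := IsClosed.completeSpace_coe (hs := hcl')
      rw [← Submodule.orthogonal_orthogonal (D r).range]
      intro y hy
      refine inner_eval_eq_zero_of_mem_singularitySpace hf hZ (fun x => ?_) _
      exact (Submodule.mem_orthogonal' _ _).1 hy _ ⟨x, rfl⟩
    obtain ⟨g, hg⟩ := hmem
    refine ⟨g, hg, (hbd' g).trans ?_⟩
    gcongr
    exact (congrArg norm hg).trans_le (norm_eval_scaledShift_vacuum_le hr f)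
  rw [← hcl.closure_eq, Metric.mem_closure_range_iff]
  intro ε hε
  have hlim : Tendsto (fun r : ℝ => ‖eval f (scaledShift ι (r : ℂ)) (vacuum ι) - f‖ +
      ‖D r - H‖ * (2 * K * ‖f‖)) (𝓝[<] 1) (𝓝 0) := by
    simpa using (tendsto_iff_norm_sub_tendsto_zero.1 (tendsto_eval_scaledShift_vacuum f)).add
      (hD.mul_const (2 * K * ‖f‖))
  obtain ⟨r, ⟨g, hg1, hg2⟩, hr⟩ := (hg.and (hlim.eventually_lt_const hε)).exists
  refine ⟨g, lt_of_le_of_lt ?_ hr⟩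
  rw [dist_comm, dist_eq_norm]
  calc ‖H g - f‖ = ‖(D r g - f) - (D r - H) g‖ := by
        rw [sub_apply]
        congr 1
        abel
    _ ≤ ‖D r g - f‖ + ‖(D r - H) g‖ := norm_sub_le _ _
    _ ≤ _ := by
      rw [hg1]
      gcongr
      exact ContinuousLinearMap.le_opNorm_of_le _ hg2


/-! ### Inner-outer factorization of multipliers with closed range -/

/-- Two suffixes of one word are comparable, so the supports are disjoint. -/
theorem inner_rightShift_of_not_suffix {i j : Word ι} (hij : ¬ i <:+ j) (hji : ¬ j <:+ i)
    (f g : NCHardy ι) : inner ℂ (rightShift i f) (rightShift j g) = 0 := by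
  rw [lp.inner_eq_tsum]
  refine (tsum_congr fun γ => ?_).trans tsum_zero
  by_cases hi : i <:+ γ
  · by_cases hj : j <:+ γ
    · rcases List.suffix_or_suffix_of_suffix hi hj with h | h
      exacts [absurd h hij, absurd h hji]
    · rw [rightShift_apply_of_not_suffix hj, inner_zero_right]
  · rw [rightShift_apply_of_not_suffix hi, inner_zero_left]

/-- Wandering vectors generate orthonormal families. -/
theorem orthonormal_rightShift {θ : NCHardy ι} (hθ : ‖θ‖ = 1)
    (h : ∀ w, w ≠ [] → inner ℂ θ (rightShift w θ) = 0) :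
    Orthonormal ℂ fun w : Word ι => rightShift w θ := by
  refine ⟨fun w => by rw [LinearIsometry.norm_map, hθ], fun i j hne => ?_⟩
  change inner ℂ (rightShift i θ) (rightShift j θ) = 0
  by_cases hij : i <:+ j
  · obtain ⟨a, rfl⟩ := hij
    rw [rightShift_append, LinearIsometry.inner_map_map]
    exact h a fun ha => hne (by simp [ha])
  by_cases hji : j <:+ i
  · obtain ⟨a, rfl⟩ := hji
    rw [rightShift_append, LinearIsometry.inner_map_map, ← inner_conj_symm,
      h a fun ha => hne (by simp [ha]), map_zero]
  exact inner_rightShift_of_not_suffix hij hji θ θ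

theorem adjoint_rightShift_rightShift (w : Word ι) (f : NCHardy ι) :
    ContinuousLinearMap.adjoint (rightShift w).toContinuousLinearMap (rightShift w f) = f :=
  DFunLike.congr_fun (rightShift w).adjoint_comp_self f

theorem adjoint_rightShift_apply (w γ : Word ι) (f : NCHardy ι) :
    ContinuousLinearMap.adjoint (rightShift w).toContinuousLinearMap f γ = f (γ ++ w) := by
  rw [← inner_monomial_left, ContinuousLinearMap.adjoint_inner_right,
    LinearIsometry.coe_toContinuousLinearMap, rightShift_monomial, inner_monomial_left]

/-- Left multipliers commute with the adjoints of the right shifts on series without constant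
term. -/
theorem IsLeftMultiplier.adjoint_rightShift_comm {H : NCHardy ι →L[ℂ] NCHardy ι}
    (hH : IsLeftMultiplier H) (k : ι) {v : NCHardy ι} (hv : v [] = 0) :
    ContinuousLinearMap.adjoint (rightShift [k]).toContinuousLinearMap (H v) =
      H (ContinuousLinearMap.adjoint (rightShift [k]).toContinuousLinearMap v) := by
  set A := ContinuousLinearMap.adjoint (rightShift [k]).toContinuousLinearMap with hA
  -- The commutator has rank at most one and sees only the constant coefficient, because `A` kills
  -- the constant series `1`.
  have : A ∘L H = H ∘L A +
      (innerSL ℂ (monomial [])).smulRight (A (H (monomial []))) := by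
    refine ext_monomial fun w => ?_
    simp only [ContinuousLinearMap.comp_apply, add_apply, ContinuousLinearMap.smulRight_apply,
      innerSL_apply_apply, inner_monomial_left]
    rcases List.eq_nil_or_concat' w with rfl | ⟨w, j, rfl⟩
    · have : A (monomial []) = 0 := by
        ext γ
        rw [hA, adjoint_rightShift_apply, monomial_apply, if_neg (by simp)]
        rfl
      rw [this]
      simp [monomial_apply]
    · have h1 : monomial (w ++ [j]) ([] : Word ι) = 0 := by simp [monomial_apply]
      rw [h1, zero_smul, add_zero, ← rightShift_monomial,
        isLeftMultiplier_iff_commute.1 hH]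
      by_cases hjk : j = k
      · subst hjk
        rw [adjoint_rightShift_rightShift, adjoint_rightShift_rightShift]
      · have h0 : ∀ f, A (rightShift [j] f) = 0 := fun f => by
          refine ext_inner_left ℂ fun g => ?_
          rw [hA, ContinuousLinearMap.adjoint_inner_right, inner_zero_right]
          refine inner_rightShift_of_not_suffix ?_ ?_ g f <;>
          · intro h
            have := h.eq_of_length rfl
            simp at this
            tauto
        rw [h0, h0, map_zero]
  have h2 := DFunLike.congr_fun this v
  simpa [inner_monomial_left, hv] using h2

/-- An injective operator with closed range has a unit vector in its range which is orthogonal to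
the image of the series without constant term. -/
theorem exists_wandering_vector {H : NCHardy ι →L[ℂ] NCHardy ι}
    (hinj : Function.Injective H) (hcl : IsClosed (Set.range H)) :
    ∃ g : NCHardy ι, ‖H g‖ = 1 ∧ inner ℂ (H g) (H (vacuum ι)) ≠ 0 ∧
      ∀ v : NCHardy ι, v [] = 0 → inner ℂ (H g) (H v) = 0 := by
  obtain ⟨K, hK⟩ := H.antilipschitz_of_injective_of_isClosed_range hinj hcl
  let N : Submodule ℂ (NCHardy ι) := (innerSL ℂ (monomial [])).ker
  have hN : ∀ v, v ∈ N ↔ v [] = 0 := fun v => by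
    rw [← inner_monomial_left]
    rfl
  let M : Submodule ℂ (NCHardy ι) := N.map H.toLinearMap
  have hM : IsClosed (M : Set (NCHardy ι)) :=
    (hK.isClosedEmbedding H.uniformContinuous).isClosedMap _
      (innerSL ℂ (monomial ([] : Word ι))).isClosed_ker
  have : CompleteSpace M := hM.completeSpace_coe
  -- The wandering vector is the normalized component of `H 1` orthogonal to `M`. It is nonzero
  -- because `1 - u` has constant term `1` and `H` is injective.
  obtain ⟨m, hm, z, hz, hmz⟩ := M.exists_add_mem_mem_orthogonal (H (vacuum ι))
  obtain ⟨u, hu, rfl⟩ := hm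
  have hzH : z = H (vacuum ι - u) := by
    rw [map_sub, hmz]
    exact (add_sub_cancel_left _ _).symm
  have hz0 : z ≠ 0 := by
    rintro rfl
    have h1 : vacuum ι - u = 0 := hinj (by rw [← hzH, map_zero])
    have h2 := congrArg (fun f : NCHardy ι => f []) h1
    simp only [lp.coeFn_sub, Pi.sub_apply, (hN u).1 hu, vacuum_eq_monomial, monomial_apply] at h2
    simp at h2
  have hzn : (‖z‖ : ℂ) ≠ 0 := by simpa using hz0
  have horth : ∀ v, v [] = 0 → inner ℂ z (H v) = 0 := fun v hv =>
    (Submodule.mem_orthogonal' M z).1 hz _ ⟨v, (hN v).2 hv, rfl⟩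
  refine ⟨(‖z‖ : ℂ)⁻¹ • (vacuum ι - u), ?_, ?_, fun v hv => ?_⟩
  · rw [map_smul, ← hzH, norm_smul]
    simp [hz0]
  · rw [map_smul, ← hzH, inner_smul_left, hmz, inner_add_right]
    have h0 : inner ℂ z (H.toLinearMap u) = 0 := horth u ((hN u).1 hu)
    rw [h0, zero_add]
    refine mul_ne_zero (by simpa using hz0) (by simpa using hz0)
  · rw [map_smul, ← hzH, inner_smul_left, horth v hv, mul_zero]

/-- The right shifts of the wandering vector `H g` are orthonormal and define `Θ` with range inside
`ran H`. Equality of the ranges is the real content: nothing nonzero in `ran H` is orthogonal to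
`ran Θ`. Then `F = Θ* H` is even surjective. -/
theorem IsLeftMultiplier.exists_innerOuterFactorization {H : NCHardy ι →L[ℂ] NCHardy ι}
    (hH : IsLeftMultiplier H) (hinj : Function.Injective H) (hcl : IsClosed (Set.range H)) :
    ∃ Θ F, IsInnerOuterFactorization H Θ F := by
  have hcomm := isLeftMultiplier_iff_commute.1 hH
  obtain ⟨g, hg1, hg2, hg3⟩ := exists_wandering_vector hinj hcl
  have horth : Orthonormal ℂ fun w : Word ι => rightShift w (H g) := by
    refine orthonormal_rightShift hg1 fun w hw => ?_
    rw [← hcomm]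
    refine hg3 _ (rightShift_apply_of_not_suffix ?_ g)
    simpa using hw
  let Θ : NCHardy ι →L[ℂ] NCHardy ι := (isometryOf horth).toContinuousLinearMap
  have hΘw : ∀ w, Θ (monomial w) = rightShift w (H g) := isometryOf_monomial horth
  have hΘ1 : Θ (monomial []) = H g := by rw [hΘw, rightShift_nil]
  have hΘ : IsLeftMultiplier Θ := isLeftMultiplier_iff.2 fun w => by rw [hΘ1, hΘw]
  have hΘcomm := isLeftMultiplier_iff_commute.1 hΘ
  have hΘinj : Function.Injective Θ := (isometryOf horth).injective
  have hΘsub : ∀ f, Θ f ∈ H.range := fun f => by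
    have hs := (hasSum_monomial f).mapL Θ
    have hcl' : IsClosed (H.range : Set (NCHardy ι)) := hcl
    refine hcl'.mem_of_tendsto hs (.of_forall fun s => ?_)
    refine Submodule.sum_mem _ fun w _ => ?_
    rw [map_smul, hΘw, ← hcomm]
    exact Submodule.smul_mem _ _ ⟨_, rfl⟩
  -- Modulo series without constant term, `v` is `v [] • 1`, and `H g` is not orthogonal to `H 1`.
  have hv0 : ∀ v, ContinuousLinearMap.adjoint Θ (H v) = 0 → v [] = 0 := fun v hv => by
    have h1 : inner ℂ (H g) (H v) = 0 := by
      rw [← hΘ1, ← ContinuousLinearMap.adjoint_inner_right, hv, inner_zero_right]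
    have h2 : inner ℂ (H g) (H (v - v [] • vacuum ι)) = 0 := by
      refine hg3 _ ?_
      rw [← inner_monomial_left, inner_sub_right, inner_smul_right, vacuum_eq_monomial,
        inner_monomial_left, inner_monomial_left, monomial_apply]
      simp
    rw [map_sub, inner_sub_right, h1, map_smul, inner_smul_right, zero_sub, neg_eq_zero,
      mul_eq_zero] at h2
    exact h2.resolve_right hg2
  -- As `v` has no constant term, stripping a last letter from `H v` gives `H v'` with `v'`
  -- satisfying the same hypothesis; so every coefficient reduces to the constant one.
  have hzero : ∀ (γ : Word ι) (v : NCHardy ι), ContinuousLinearMap.adjoint Θ (H v) = 0 →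
      H v γ = 0 := by
    intro γ
    induction γ using List.reverseRecOn with
    | nil =>
      intro v hv
      rw [apply_eq_cauchyProduct (isLeftMultiplier_iff.1 hH)]
      simp [cauchyProduct, hv0 v hv]
    | append_singleton γ k ih =>
      intro v hv
      have hk := hH.adjoint_rightShift_comm k (hv0 v hv)
      rw [← adjoint_rightShift_apply, hk]
      refine ih _ (ext_inner_left ℂ fun y => ?_)
      rw [← hk, ContinuousLinearMap.adjoint_inner_right,
        ContinuousLinearMap.adjoint_inner_right, LinearIsometry.coe_toContinuousLinearMap,
        ← hΘcomm, ← ContinuousLinearMap.adjoint_inner_right, hv]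
      simp
  have hadj : ∀ f, ContinuousLinearMap.adjoint Θ (Θ f) = f :=
    DFunLike.congr_fun (isometryOf horth).adjoint_comp_self
  let F : NCHardy ι →L[ℂ] NCHardy ι := ContinuousLinearMap.adjoint Θ ∘L H
  have hfac : ∀ v, H v = Θ (F v) := fun v => by
    -- Write the projection of `H v` onto `ran Θ` as `H u`; then `Θ*` kills `H (v - u)`, which
    -- therefore vanishes.
    obtain ⟨u, hu⟩ := hΘsub (F v)
    have hu' : H u = Θ (F v) := hu
    have h0 : H (v - u) = 0 := by
      ext γ
      refine hzero γ _ ?_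
      rw [map_sub, hu', map_sub, hadj]
      exact sub_self _
    rw [map_sub, sub_eq_zero] at h0
    rw [h0, hu']
  refine ⟨Θ, F, ⟨hΘ, (isometryOf horth).isometry⟩, ⟨?_, ?_⟩, ContinuousLinearMap.ext hfac⟩
  · refine isLeftMultiplier_iff_commute.2 fun w f => hΘinj ?_
    rw [← hfac, hcomm, hΘcomm, ← hfac]
  · refine Function.Surjective.denseRange fun f => ?_
    obtain ⟨v, hv⟩ := hΘsub f
    exact ⟨v, hΘinj ((hfac v).symm.trans hv)⟩

/-! ### Inner factors -/

/-- Since `Θ` is injective, `ran F` is the preimage of `ran H` under `Θ`, so it is closed as well as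
dense. -/
theorem IsInnerOuterFactorization.surjective {H Θ F : NCHardy ι →L[ℂ] NCHardy ι}
    (h : IsInnerOuterFactorization H Θ F) (hcl : IsClosed (Set.range H)) :
    Function.Surjective F := by
  obtain ⟨⟨-, hΘ⟩, ⟨-, hF⟩, rfl⟩ := h
  have h1 : Set.range F = Θ ⁻¹' Set.range (Θ ∘L F) := by
    rw [ContinuousLinearMap.coe_comp, Set.range_comp, Set.preimage_image_eq _ hΘ.injective]
  have h2 : IsClosed (Set.range F) := h1 ▸ hcl.preimage Θ.continuous
  rw [← Set.range_eq_univ, ← h2.closure_eq]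
  exact hF.closure_range

theorem range_subset_singularitySpace {Θ : NCHardy ι →L[ℂ] NCHardy ι} (hΘ : IsLeftMultiplier Θ) :
    Set.range Θ ⊆ singularitySpace (Θ (vacuum ι)) := by
  rintro _ ⟨f, rfl⟩
  refine ⟨fun n p hp x => ?_, fun p hp x => ?_⟩ <;>
  · rw [hp.1.eval_mul hΘ]
    exact hp.2 _

/-- Solving `F g = 1` gives `F(Z) g(Z) = 1`, so `y* Θ(Z) = y* H(Z) g(Z)`. -/
theorem IsInnerOuterFactorization.sing_subset {H Θ F : NCHardy ι →L[ℂ] NCHardy ι}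
    (h : IsInnerOuterFactorization H Θ F) (hF : Function.Surjective F) {E : Type*}
    [NormedAddCommGroup E] [InnerProductSpace ℂ E] [CompleteSpace E] :
    Sing E (H (vacuum ι)) ⊆ Sing E (Θ (vacuum ι)) := by
  rintro ⟨Z, y⟩ ⟨hZ, hy⟩
  refine ⟨hZ, fun x => ?_⟩
  obtain ⟨g, hg⟩ := hF (vacuum ι)
  have h1 : eval (F (vacuum ι)) Z * eval g Z = 1 := by
    rw [← hZ.eval_mul h.2.1.1, hg, vacuum_eq_monomial, eval_monomial]
    simp
  have h2 := hy (eval g Z x)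
  rw [h.2.2, ContinuousLinearMap.comp_apply] at h2
  change inner ℂ y (eval (Θ (F (vacuum ι))) Z (eval g Z x)) = 0 at h2
  rw [hZ.eval_mul h.1.1] at h2
  have h3 : eval (F (vacuum ι)) Z (eval g Z x) = x := DFunLike.congr_fun h1 x
  rwa [mul_apply_eq_comp, h3] at h2

theorem IsInnerOuterFactorization.isBlaschke [Countable ι] {H Θ F : NCHardy ι →L[ℂ] NCHardy ι}
    (h : IsInnerOuterFactorization H Θ F) (hH : H ∈ diskAlgebra ι) (hne : H ≠ 0)
    (hcl : IsClosed (Set.range H)) : IsBlaschke Θ := by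
  have hF := h.surjective hcl
  refine ⟨h.1, (range_subset_singularitySpace h.1.1).antisymm fun f hf => ?_⟩
  have hfH : f ∈ singularitySpace (H (vacuum ι)) :=
    ⟨fun n p hp => hf.1 n p (h.sing_subset hF hp), fun p hp => hf.2 p (h.sing_subset hF hp)⟩
  obtain ⟨v, rfl⟩ := mem_range_of_mem_singularitySpace hH hne hcl hfH
  exact ⟨F v, by rw [h.2.2]; rfl⟩

end NCHardy

theorem mainTheorem6 {ι : Type*} [Countable ι] :
    (∀ H ∈ NCHardy.diskAlgebra ι, H ≠ 0 → IsClosed (Set.range H) →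
      (∃ Θ F, NCHardy.IsInnerOuterFactorization H Θ F) ∧
      ∀ Θ F, NCHardy.IsInnerOuterFactorization H Θ F → NCHardy.IsBlaschke Θ) ∧
    (∀ V ∈ NCHardy.diskAlgebra ι, Isometry V → NCHardy.IsBlaschke V) := by
  refine ⟨fun H hH hne hcl => ⟨?_, fun Θ F h => h.isBlaschke hH hne hcl⟩, fun V hV hiso => ?_⟩
  · have hm := NCHardy.diskAlgebra_le_leftMultipliers hH
    exact NCHardy.IsLeftMultiplier.exists_innerOuterFactorization hm
      ((injective_iff_map_eq_zero H).2 fun g hg => (hm.eq_zero_or_eq_zero hg).resolve_left hne) hcl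
  · have hne : V ≠ 0 := by
      rintro rfl
      have h1 := hiso.dist_eq (NCHardy.vacuum ι) 0
      rw [dist_zero_right, NCHardy.vacuum_eq_monomial, NCHardy.norm_monomial] at h1
      simp at h1
    -- An isometry is its own inner factor, with outer factor the identity, and its range is closed.
    refine NCHardy.IsInnerOuterFactorization.isBlaschke (F := 1)
      ⟨⟨NCHardy.diskAlgebra_le_leftMultipliers hV, hiso⟩,
        ⟨NCHardy.isLeftMultiplier_one, Function.surjective_id.denseRange⟩, rfl⟩ hV hne
      hiso.isClosedEmbedding.isClosed_range
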